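/- Let $M\ge 1$, let $\epsilon_1,\dots,\epsilon_M\in(0,1/2)$, and put $\bar C=\sum_{m=1}^M\bigl(\tfrac12-\sqrt{\epsilon_m(1-\epsilon_m)}\bigr)$. A target $X^*$ is a random point of $[0,1]$ with an arbitrary (possibly degenerate) distribution. The sequential $M$-player bisection with step size $\Delta>0$, $K=\Delta^{-1}\in\mathbb N$, implemented by the Burnashev–Zigangirov (BZ) algorithm, runs as follows. Let $I_1=[0,\Delta]$ and $I_i=((i-1)\Delta,i\Delta]$ for $2\le i\le K$. The controller keeps a probability vector $a=(a_1,\dots,a_K)$, representing the density $p=\Delta^{-1}\sum_i a_i 1_{I_i}$ and starting from $a_i=\Delta$ for all $i$. In every cycle the players $m=1,\dots,M$ are asked one question each, in this order: 1. Let $k$ be the index with $\sum_{i<k}a_i\le\frac12<\sum_{i\le k}a_i$, and let $\tau_1=\sum_{i\ge k}a_i-\sum_{i<k}a_i$, $\tau_2=\sum_{i\le k}a_i-\sum_{i>k}a_i$. The query point $q$ is $(k-1)\Delta$ with probability $\tau_2/(\tau_1+\tau_2)$ and $k\Delta$ with probability $\tau_1/(\tau_1+\tau_2)$, conditionally on all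 past queries and answers and on $X^*$. 2. Player $m$ is asked whether $X^*\le q$; conditionally on all past queries and answers, on $X^*$ and on $q$, the answer is correct with probability $1-\epsilon_m$ and wrong with probability $\epsilon_m$. 3. The vector $a$ is replaced by its Bayes update for this answer, computed with the error probability $\alpha_m=\sqrt{\epsilon_m}/(\sqrt{\epsilon_m}+\sqrt{1-\epsilon_m})$: $a_i$ is multiplied by $1-\alpha_m$ if $I_i$ lies on the side of $q$ indicated by the answer and by $\alpha_m$ otherwise, and the result is normalized to total mass $1$. Let $\hat X_n$ be the median of the density $p$ after $n$ full cycles. Then, for every $n\ge 0$: (a) for every step size $\Delta$ with $\Delta^{-1}\in\mathbb N$, $$\mathbb P\bigl(|X^*-\hat X_n|>\Delta\bigr)\le\Bigl(\frac1\Delta-1\Bigr)\exp(-n\bar C);$$ (b) if the step size is chosen as $\Delta=\Delta_n=\bigl\lceil 2^{1/3}e^{n\bar C/3}\bigr\rceil^{-1}$, then $$\mathbb E\bigl[(X^*-\hat X_n)^2\bigr]\le\bigl(2^{-2/3}+2^{1/3}\bigr)\exp\bigl(-\tfrac23 n\bar C\bigr).$$ -/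

import Mathlib

open MeasureTheory ProbabilityTheory

noncomputable section

/-- Posterior mass of the first `j` of the `K` bins, i.e. of `[0, j / K]`. -/
def bzLeft {K : ℕ} (a : Fin K → ℝ) (j : ℕ) : ℝ := ∑ i : Fin K, if i.val < j then a i else 0

/-- Posterior mass of the remaining bins, i.e. of `(j / K, 1]`. -/
def bzRight {K : ℕ} (a : Fin K → ℝ) (j : ℕ) : ℝ := ∑ i : Fin K, if i.val < j then 0 else a i

/-- The (one-based) number `k` of the bin that contains the posterior median: the mass of the
first `k` bins exceeds `1/2`, that of the first `k - 1` bins does not. -/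
def bzMedianBin {K : ℕ} (a : Fin K → ℝ) : ℕ := sInf {k : ℕ | 1 / 2 < bzLeft a k}

/-- Excess of the mass to the right of the left end point of the median bin. -/
def bzTau₁ {K : ℕ} (a : Fin K → ℝ) : ℝ :=
  bzRight a (bzMedianBin a - 1) - bzLeft a (bzMedianBin a - 1)

/-- Excess of the mass to the left of the right end point of the median bin. -/
def bzTau₂ {K : ℕ} (a : Fin K → ℝ) : ℝ :=
  bzLeft a (bzMedianBin a) - bzRight a (bzMedianBin a)

/-- The biased coin of the Burnashev-Zigangirov algorithm: the probability that, at the discretized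
posterior `a`, the next query is placed at the grid point `j / K`. Only the two end points
`(k - 1) / K` and `k / K` of the median bin are used. -/
def bzQueryProb {K : ℕ} (a : Fin K → ℝ) (j : ℕ) : ℝ :=
  if j = bzMedianBin a - 1 then bzTau₂ a / (bzTau₁ a + bzTau₂ a)
  else if j = bzMedianBin a then bzTau₁ a / (bzTau₁ a + bzTau₂ a)
  else 0

/-- Bayes update of the discretized posterior, with assumed error probability `α`, after the answer
`y` to the question "is the target in `[0, j / K]`?" (`true` means yes). -/
def bzUpdate {K : ℕ} (α : ℝ) (a : Fin K → ℝ) (j : ℕ) (y : Bool) : Fin K → ℝ :=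
  fun i => (if (i.val < j ↔ y = true) then 1 - α else α) * a i /
    ∑ l : Fin K, (if (l.val < j ↔ y = true) then 1 - α else α) * a l

/-- The update parameter used for a player with error probability `e`. -/
def bzAlpha (e : ℝ) : ℝ := √e / (√e + √(1 - e))

/-- The discretized posterior after `t` questions, as a function of the grid points `q s / K` that
were queried and of the answers `y s`, `s < t`. Question `t` goes to player `t mod M`, so a cycle
through all the players consists of `M` consecutive questions. The initial posterior is uniform. -/
def bzPosterior {M : ℕ} [NeZero M] (ε : Fin M → ℝ) (K : ℕ) (q : ℕ → ℕ) (y : ℕ → Bool) :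
    ℕ → Fin K → ℝ
  | 0 => fun _ => 1 / (K : ℝ)
  | t + 1 => bzUpdate (bzAlpha (ε (Fin.ofNat M t))) (bzPosterior ε K q y t) (q t) (y t)

/-- The bins `[0, 1 / K]`, `(1 / K, 2 / K]`, …, `((K - 1) / K, 1]`. -/
def bzBin (K : ℕ) (i : Fin K) : Set ℝ :=
  if i.val = 0 then Set.Icc 0 (1 / (K : ℝ))
  else Set.Ioc ((i.val : ℝ) / K) (((i.val : ℝ) + 1) / K)

/-- The piecewise constant density with mass `a i` in bin `i`. -/
def bzDensity {K : ℕ} (a : Fin K → ℝ) (x : ℝ) : ℝ :=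
  (K : ℝ) * ∑ i : Fin K, (bzBin K i).indicator (fun _ => a i) x

/-- The median of the piecewise constant density with masses `a`. -/
def bzMedian {K : ℕ} (a : Fin K → ℝ) : ℝ :=
  sInf {x : ℝ | 0 ≤ x ∧ x ≤ 1 ∧ 1 / 2 ≤ ∫ z in (0 : ℝ)..x, bzDensity a z}

/-- The estimate of the target after `n` full cycles, i.e. after `n * M` questions. -/
def bzEstimate {M : ℕ} [NeZero M] (ε : Fin M → ℝ) (K : ℕ) (q : ℕ → ℕ) (y : ℕ → Bool)
    (n : ℕ) : ℝ :=
  bzMedian (bzPosterior ε K q y (n * M))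

/-- The information of the controller before question `t`: all earlier queries and answers. -/
abbrev bzInfo {Ω : Type*} (Q : ℕ → Ω → ℕ) (Y : ℕ → Ω → Bool) (t : ℕ) : MeasurableSpace Ω :=
  ⨆ s : ℕ, ⨆ _ : s < t,
    MeasurableSpace.comap (Q s) inferInstance ⊔ MeasurableSpace.comap (Y s) inferInstance

/-- A run of the sequential `M`-player bisection by the Burnashev-Zigangirov algorithm with `K` bins:
the target `X` is a random point of the unit interval, question `t` is "is `X ≤ Q t / K`?", put to
player `t mod M`, and `Y t` is the answer.
* Given the past and the target, the query point is drawn by the biased coin of the algorithm.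
* Given the past, the target and the query, the answer is that of a binary symmetric channel with
  the crossover probability of the player who is asked. -/
structure IsBZRun {Ω : Type*} [MeasurableSpace Ω] (μ : Measure Ω) {M : ℕ} [NeZero M]
    (ε : Fin M → ℝ) (K : ℕ) (X : Ω → ℝ) (Q : ℕ → Ω → ℕ) (Y : ℕ → Ω → Bool) : Prop where
  measurable_target : Measurable X
  target_mem : ∀ᵐ ω ∂μ, X ω ∈ Set.Icc (0 : ℝ) 1
  measurable_query : ∀ t, Measurable (Q t)
  measurable_answer : ∀ t, Measurable (Y t)
  query_law : ∀ t j,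
    μ⟦{ω | Q t ω = j} | bzInfo Q Y t ⊔ MeasurableSpace.comap X inferInstance⟧ =ᵐ[μ]
      fun ω => bzQueryProb (bzPosterior ε K (fun s => Q s ω) (fun s => Y s ω) t) j
  answer_law : ∀ t,
    μ⟦{ω | Y t ω = true} | (bzInfo Q Y t ⊔ MeasurableSpace.comap X inferInstance) ⊔
        MeasurableSpace.comap (Q t) inferInstance⟧ =ᵐ[μ]
      fun ω => if X ω ≤ (Q t ω : ℝ) / K then 1 - ε (Fin.ofNat M t) else ε (Fin.ofNat M t)

/-- The rate constant: the sum over the players of `1/2 - √(ε (1 - ε))`. -/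
def bzRate {M : ℕ} (ε : Fin M → ℝ) : ℝ := ∑ m : Fin M, (1 / 2 - √(ε m * (1 - ε m)))

end

/-! Let `θ` be the bin of the target and take as potential the posterior odds against it, `1 / a θ -
1`. It starts at `K - 1`, and each question to a player with error probability `e` multiplies its
mean by at most `1/2 + √(e (1 - e)) ≤ exp (-(1/2 - √(e (1 - e))))`, so after `n` cycles the mean is
at most `(K - 1) exp (-n C̄)`. If the estimate misses by more than `1 / K`, then bin `θ` has mass
below `1/2` and the odds exceed 1; Markov's inequality gives (a). For (b), the squared error is at
most `1 / K ^ 2` off the failure event and at most 1 on it; the prescribed `K` balances the two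
terms.

The contraction has two halves. Averaging over the answer (`IsPosProb.answer_step`), `1 / a θ`
becomes `(S + (1 - S) ρ) / a θ`, where `S` is the mass on the target's side of the query and `ρ = 2
√(e (1 - e))` is the least value of `(1 - e) x + e / x`, attained at `x = α / (1 - α)`. Averaging
over the coin (`IsPosProb.query_step`), the mean of `S` is at most `(1 + a θ) / 2`. Both hold for
every fixed `θ`, so the law of the target plays no role. -/

/-- A probability vector all of whose entries are positive. -/
structure IsPosProb {K : ℕ} (a : Fin K → ℝ) : Prop where
  pos : ∀ i, 0 < a i
  sum_eq : ∑ i, a i = 1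

/-! ### Masses on either side of a grid point, and the Bayes update -/

theorem bzLeft_add_bzRight {K : ℕ} (a : Fin K → ℝ) (j : ℕ) :
    bzLeft a j + bzRight a j = ∑ i, a i := by
  rw [bzLeft, bzRight, ← Finset.sum_add_distrib]
  exact Finset.sum_congr rfl fun i _ => by split_ifs <;> simp

theorem bzLeft_zero {K : ℕ} (a : Fin K → ℝ) : bzLeft a 0 = 0 := by
  simp [bzLeft]

theorem bzLeft_card {K : ℕ} (a : Fin K → ℝ) : bzLeft a K = ∑ i, a i := by
  simp [bzLeft]

theorem bzLeft_succ {K : ℕ} (a : Fin K → ℝ) (i : Fin K) :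
    bzLeft a (i + 1) = bzLeft a i + a i := by
  have h : a i = ∑ l : Fin K, if l = i then a l else 0 := by simp
  rw [h, bzLeft, bzLeft, ← Finset.sum_add_distrib]
  refine Finset.sum_congr rfl fun l _ => ?_
  by_cases hl : l = i
  · subst hl
    simp
  · have : l.val ≠ i.val := fun e => hl (Fin.ext e)
    rw [if_neg hl, add_zero]
    exact if_congr (by lia) rfl rfl

theorem IsPosProb.bzLeft_nonneg {K : ℕ} {a : Fin K → ℝ} (ha : IsPosProb a) (j : ℕ) :
    0 ≤ bzLeft a j :=
  Finset.sum_nonneg fun i _ => by split_ifs; exacts [(ha.pos i).le, le_rfl]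

theorem IsPosProb.bzRight_nonneg {K : ℕ} {a : Fin K → ℝ} (ha : IsPosProb a) (j : ℕ) :
    0 ≤ bzRight a j :=
  Finset.sum_nonneg fun i _ => by split_ifs; exacts [le_rfl, (ha.pos i).le]

theorem IsPosProb.bzRight_eq {K : ℕ} {a : Fin K → ℝ} (ha : IsPosProb a) (j : ℕ) :
    bzRight a j = 1 - bzLeft a j := by
  have := bzLeft_add_bzRight a j
  rw [ha.sum_eq] at this
  linarith

theorem isPosProb_uniform {K : ℕ} (hK : 0 < K) : IsPosProb (fun _ : Fin K => 1 / (K : ℝ)) where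
  pos _ := by positivity
  sum_eq := by
    have : (K : ℝ) ≠ 0 := by positivity
    simp [this]

/-- The median bin `k` satisfies `∑_{i < k} a i ≤ 1/2 < ∑_{i ≤ k} a i` and `1 ≤ k ≤ K`. -/
theorem IsPosProb.bzMedianBin_spec {K : ℕ} {a : Fin K → ℝ} (ha : IsPosProb a) :
    ∃ i : Fin K, bzMedianBin a = i + 1 ∧ bzLeft a i ≤ 1 / 2 ∧ 1 / 2 < bzLeft a (i + 1) := by
  have hne : {k : ℕ | 1 / 2 < bzLeft a k}.Nonempty :=
    ⟨K, by simp only [Set.mem_ofPred_eq, bzLeft_card, ha.sum_eq]; norm_num⟩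
  have hmem : 1 / 2 < bzLeft a (bzMedianBin a) := Nat.sInf_mem hne
  have hmin : ∀ j, 1 / 2 < bzLeft a j → bzMedianBin a ≤ j := fun j hj => Nat.sInf_le hj
  have h0 : bzMedianBin a ≠ 0 := by
    intro h
    rw [h, bzLeft_zero] at hmem
    norm_num at hmem
  have hle : bzMedianBin a ≤ K := by
    apply hmin
    rw [bzLeft_card, ha.sum_eq]
    norm_num
  obtain ⟨k, hk⟩ := Nat.exists_eq_succ_of_ne_zero h0
  refine ⟨⟨k, by lia⟩, hk, ?_, by rw [hk] at hmem; exact hmem⟩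
  by_contra! h
  have := hmin _ h
  simp only at this
  lia

/-- Mass of the side of the grid point `j` that contains bin `θ`. -/
noncomputable def bzSideMass {K : ℕ} (a : Fin K → ℝ) (θ : Fin K) (j : ℕ) : ℝ :=
  if θ.val < j then bzLeft a j else bzRight a j

theorem IsPosProb.bzSideMass_mem {K : ℕ} {a : Fin K → ℝ} (ha : IsPosProb a) (θ : Fin K) (j : ℕ) :
    bzSideMass a θ j ∈ Set.Icc (0 : ℝ) 1 := by
  have h1 := ha.bzLeft_nonneg j
  have h2 := ha.bzRight_nonneg j
  have h3 := ha.bzRight_eq j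
  rw [bzSideMass]
  split_ifs <;> constructor <;> linarith

theorem IsPosProb.bzUpdate_denom {K : ℕ} {a : Fin K → ℝ} (ha : IsPosProb a) (α : ℝ) (j : ℕ)
    (y : Bool) :
    ∑ l : Fin K, (if (l.val < j ↔ y = true) then 1 - α else α) * a l =
      if y then (1 - α) * bzLeft a j + α * (1 - bzLeft a j)
      else α * bzLeft a j + (1 - α) * (1 - bzLeft a j) := by
  rw [← ha.bzRight_eq]
  cases y
  · simp only [Bool.false_eq_true, iff_false, if_false, bzLeft, bzRight, Finset.mul_sum,
      ← Finset.sum_add_distrib]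
    exact Finset.sum_congr rfl fun l _ => by split_ifs <;> simp_all
  · simp only [iff_true, if_true, bzLeft, bzRight, Finset.mul_sum, ← Finset.sum_add_distrib]
    exact Finset.sum_congr rfl fun l _ => by split_ifs <;> simp_all

theorem IsPosProb.bzUpdate_denom_pos {K : ℕ} {a : Fin K → ℝ} (ha : IsPosProb a) {α : ℝ}
    (hα : 0 < α) (hα' : α < 1) (j : ℕ) (y : Bool) :
    0 < ∑ l : Fin K, (if (l.val < j ↔ y = true) then 1 - α else α) * a l := by
  have hne : (Finset.univ : Finset (Fin K)).Nonempty := by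
    rw [Finset.nonempty_iff_ne_empty]
    intro h
    have := ha.sum_eq
    rw [h] at this
    simp at this
  refine Finset.sum_pos (fun l _ => mul_pos ?_ (ha.pos l)) hne
  split_ifs <;> linarith

theorem IsPosProb.bzUpdate_isPosProb {K : ℕ} {a : Fin K → ℝ} (ha : IsPosProb a) {α : ℝ}
    (hα : 0 < α) (hα' : α < 1) (j : ℕ) (y : Bool) : IsPosProb (bzUpdate α a j y) where
  pos i := by
    refine div_pos (mul_pos ?_ (ha.pos i)) (ha.bzUpdate_denom_pos hα hα' j y)
    split_ifs <;> linarith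
  sum_eq := by
    unfold bzUpdate
    rw [← Finset.sum_div, div_self (ha.bzUpdate_denom_pos hα hα' j y).ne']

/-- For `α ≤ 1/2` every weight lies between `α` and 1, so the numerator is at least `α * a i` and
the normalizer at most 1. This keeps the potential bounded at each time, hence integrable. -/
theorem IsPosProb.le_bzUpdate {K : ℕ} {a : Fin K → ℝ} (ha : IsPosProb a) {α : ℝ}
    (hα : 0 < α) (hα' : α ≤ 1 / 2) (j : ℕ) (y : Bool) (i : Fin K) :
    α * a i ≤ bzUpdate α a j y i := by
  have hd := ha.bzUpdate_denom_pos hα (by linarith) j y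
  have hd1 : ∑ l : Fin K, (if (l.val < j ↔ y = true) then 1 - α else α) * a l ≤ 1 := by
    refine le_of_le_of_eq ?_ ha.sum_eq
    refine Finset.sum_le_sum fun l _ => ?_
    have := ha.pos l
    split_ifs <;> nlinarith
  have hai := ha.pos i
  have hw : α * a i ≤ (if (i.val < j ↔ y = true) then 1 - α else α) * a i := by
    refine mul_le_mul_of_nonneg_right ?_ hai.le
    split_ifs <;> linarith
  have hpos : 0 < α * a i := mul_pos hα hai
  unfold bzUpdate
  rw [le_div_iff₀ hd]
  nlinarith

/-- Inverting puts the normalizer in the numerator, where it is affine in the side mass. This is why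
the potential is built from `1 / a θ`: its mean over answers is then explicit. -/
theorem bzUpdate_apply_inv {K : ℕ} {a : Fin K → ℝ} (ha : IsPosProb a) {α : ℝ}
    (θ : Fin K) (j : ℕ) (y : Bool) :
    1 / bzUpdate α a j y θ =
      if (θ.val < j ↔ y = true) then
        ((1 - α) * bzSideMass a θ j + α * (1 - bzSideMass a θ j)) / ((1 - α) * a θ)
      else (α * bzSideMass a θ j + (1 - α) * (1 - bzSideMass a θ j)) / (α * a θ) := by
  unfold bzUpdate bzSideMass
  rw [ha.bzUpdate_denom, ha.bzRight_eq, one_div_div]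
  by_cases h : θ.val < j <;> cases y <;> simp [h] <;> ring

/-! ### The tuned update parameter -/

section Alpha

variable {e : ℝ}

theorem bzAlpha_pos (h0 : 0 < e) : 0 < bzAlpha e := by
  have := Real.sqrt_pos.2 h0
  have := Real.sqrt_nonneg (1 - e)
  unfold bzAlpha
  positivity

theorem bzAlpha_le_half (h0 : 0 < e) (h1 : e < 1 / 2) : bzAlpha e ≤ 1 / 2 := by
  have h2 := Real.sqrt_pos.2 h0
  have h3 : √e ≤ √(1 - e) := Real.sqrt_le_sqrt (by linarith)
  unfold bzAlpha
  rw [div_le_div_iff₀ (by linarith) (by norm_num)]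
  linarith

/-- With the tuned update parameter, the mean inverse likelihood ratio is `2 √(e (1 - e))`. -/
theorem bzAlpha_tuning (h0 : 0 < e) (h1 : e < 1 / 2) :
    (1 - e) * (bzAlpha e / (1 - bzAlpha e)) + e * ((1 - bzAlpha e) / bzAlpha e) =
      2 * √(e * (1 - e)) := by
  have h2 := Real.sqrt_pos.2 h0
  have h3 : 0 < √(1 - e) := Real.sqrt_pos.2 (by linarith)
  have h4 : 1 - bzAlpha e = √(1 - e) / (√e + √(1 - e)) := by
    unfold bzAlpha
    field_simp
    ring
  rw [h4, bzAlpha, Real.sqrt_mul h0.le, div_div_div_cancel_right₀ (by positivity),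
    div_div_div_cancel_right₀ (by positivity)]
  have h5 := Real.sq_sqrt h0.le
  have h6 : √(1 - e) ^ 2 = 1 - e := Real.sq_sqrt (by linarith)
  field_simp
  rw [h5, h6]
  ring

theorem two_mul_sqrt_mul_le_one (e : ℝ) : 2 * √(e * (1 - e)) ≤ 1 := by
  have : √(e * (1 - e)) ≤ 1 / 2 := by
    rw [Real.sqrt_le_left (by norm_num)]
    nlinarith [sq_nonneg (e - 1 / 2)]
  linarith

end Alpha

/-! ### Contraction of the potential by one question -/

/-- Mean of the potential `1 / a θ - 1` after an answer to the query `j`. -/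
noncomputable def bzAnswerMean {K : ℕ} (e : ℝ) (a : Fin K → ℝ) (θ : Fin K) (j : ℕ) : ℝ :=
  (bzSideMass a θ j + (1 - bzSideMass a θ j) * (2 * √(e * (1 - e)))) / a θ - 1

/-- The answer probability may be misspecified at the query `j = 0`, which is uninformative. -/
theorem IsPosProb.answer_step {K : ℕ} {a : Fin K → ℝ} (ha : IsPosProb a) {e p : ℝ}
    (h0 : 0 < e) (h1 : e < 1 / 2) (θ : Fin K) (j : ℕ)
    (hp : 0 < j → p = if θ.val < j then 1 - e else e) :
    p * (1 / bzUpdate (bzAlpha e) a j true θ - 1) +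
      (1 - p) * (1 / bzUpdate (bzAlpha e) a j false θ - 1) = bzAnswerMean e a θ j := by
  have hα := bzAlpha_pos h0
  have hα' : 0 < 1 - bzAlpha e := by linarith [bzAlpha_le_half h0 h1]
  have haθ := ha.pos θ
  rw [bzUpdate_apply_inv ha, bzUpdate_apply_inv ha, bzAnswerMean, ← bzAlpha_tuning h0 h1]
  -- At `j = 0` all bins lie on the same side, so either answer leaves the posterior unchanged and
  -- `p` cancels. This covers a target at exactly 0, for which the true answer is yes although its
  -- bin lies to the right of the query.
  rcases Nat.eq_zero_or_pos j with rfl | hj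
  · have hS : bzSideMass a θ 0 = 1 := by simp [bzSideMass, ha.bzRight_eq, bzLeft_zero]
    simp only [hS, not_lt_zero, false_iff, Bool.false_eq_true, not_true, if_true,
      if_false]
    field_simp
    ring
  · rw [hp hj]
    by_cases h : θ.val < j <;>
      simp only [h, if_true, if_false, Bool.false_eq_true, iff_true, iff_false, not_true] <;>
      field_simp <;> ring

theorem bzQueryProb_sum {K : ℕ} {a : Fin K → ℝ} {i : Fin K} (hi : bzMedianBin a = i + 1)
    (φ : ℕ → ℝ) :
    ∑ j ∈ Finset.range (K + 1), bzQueryProb a j * φ j =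
      bzTau₂ a / (bzTau₁ a + bzTau₂ a) * φ i + bzTau₁ a / (bzTau₁ a + bzTau₂ a) * φ (i + 1) := by
  have hi' := i.isLt
  rw [← Finset.sum_subset (s₁ := {i.val, i.val + 1})]
  · rw [Finset.sum_pair (by lia)]
    simp [bzQueryProb, hi]
  · intro j hj
    simp only [Finset.mem_insert, Finset.mem_singleton] at hj
    rw [Finset.mem_range]
    lia
  · intro j _ hj
    simp only [Finset.mem_insert, Finset.mem_singleton, not_or] at hj
    simp [bzQueryProb, hi, hj.1, hj.2]

theorem IsPosProb.bzQueryProb_of_gt {K : ℕ} {a : Fin K → ℝ} (ha : IsPosProb a) {j : ℕ}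
    (hj : K < j) : bzQueryProb a j = 0 := by
  obtain ⟨i, hi, -⟩ := ha.bzMedianBin_spec
  have := i.isLt
  rw [bzQueryProb, hi, if_neg (by lia), if_neg (by lia)]

/-- One question contracts the potential by the factor `1/2 + √(e (1 - e))` in the mean. -/
theorem IsPosProb.query_step {K : ℕ} {a : Fin K → ℝ} (ha : IsPosProb a) {e : ℝ}
    (h0 : 0 < e) (h1 : e < 1 / 2) (θ : Fin K) :
    ∑ j ∈ Finset.range (K + 1), bzQueryProb a j * bzAnswerMean e a θ j ≤
      (1 / 2 + √(e * (1 - e))) * (1 / a θ - 1) := by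
  obtain ⟨i, hi, hl, hr⟩ := ha.bzMedianBin_spec
  rw [bzQueryProb_sum hi]
  have hsucc := bzLeft_succ a i
  have haθ := ha.pos θ
  have hai := ha.pos i
  have hr1 := two_mul_sqrt_mul_le_one e
  have hr0 := Real.sqrt_nonneg (e * (1 - e))
  have ht1 : bzTau₁ a = 1 - 2 * bzLeft a i := by
    rw [bzTau₁, hi, ha.bzRight_eq, Nat.add_sub_cancel]
    ring
  have ht2 : bzTau₂ a = 2 * bzLeft a i + 2 * a i - 1 := by
    rw [bzTau₂, hi, ha.bzRight_eq, hsucc]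
    ring
  have hsum : bzTau₁ a + bzTau₂ a = 2 * a i := by rw [ht1, ht2]; ring
  -- Since `τ₁ + τ₂ = 2 * a i`, this bounds the mean side mass by `(1 + a θ) / 2`. Off the median
  -- bin the coin makes that mean exactly `1/2`.
  have key : bzTau₂ a * bzSideMass a θ i + bzTau₁ a * bzSideMass a θ (i + 1) ≤
      a i * (1 + a θ) := by
    unfold bzSideMass
    rw [ht1, ht2, ha.bzRight_eq, ha.bzRight_eq, hsucc]
    rcases lt_trichotomy θ.val i.val with h | h | h
    · rw [if_pos h, if_pos (by lia)]
      nlinarith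
    · have : θ = i := Fin.ext h
      subst this
      rw [if_neg (by lia), if_pos (by lia)]
      -- In the median bin the gap between the two sides is exactly this square.
      nlinarith [sq_nonneg (2 * bzLeft a θ + a θ - 1)]
    · rw [if_neg (by lia), if_neg (by lia)]
      nlinarith
  unfold bzAnswerMean
  rw [hsum]
  generalize √(e * (1 - e)) = r at *
  generalize bzSideMass a θ i = S at *
  generalize bzSideMass a θ (i + 1) = S' at *
  have e1 : bzTau₂ a / (2 * a i) * ((S + (1 - S) * (2 * r)) / a θ - 1) +
      bzTau₁ a / (2 * a i) * ((S' + (1 - S') * (2 * r)) / a θ - 1) =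
      ((1 - 2 * r) * (bzTau₂ a * S + bzTau₁ a * S') + (bzTau₁ a + bzTau₂ a) * (2 * r)
        - (bzTau₁ a + bzTau₂ a) * a θ) / (2 * a i * a θ) := by
    field_simp
    ring
  have e2 : (1 / 2 + r) * (1 / a θ - 1) =
      ((1 / 2 + r) * (1 - a θ) * (2 * a i)) / (2 * a i * a θ) := by
    field_simp
  rw [e1, e2, hsum]
  refine div_le_div_of_nonneg_right ?_ (by positivity)
  have := mul_le_mul_of_nonneg_left key (show 0 ≤ 1 - 2 * r by linarith)
  linarith

/-! ### Bins, the piecewise constant density and its median -/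

/-- The bin that contains the point `x` of the unit interval. -/
noncomputable def bzTargetBin {K : ℕ} (hK : 0 < K) (x : ℝ) : Fin K :=
  -- Truncated subtraction puts 0 into the first bin; the minimum only matters for points beyond 1.
  ⟨min (⌈K * x⌉₊ - 1) (K - 1), by lia⟩

theorem measurable_bzTargetBin {K : ℕ} (hK : 0 < K) : Measurable (bzTargetBin hK) :=
  (Measurable.of_discrete (f := fun n : ℕ => (⟨min (n - 1) (K - 1), by lia⟩ : Fin K))).comp
    (Nat.measurable_ceil.comp (measurable_const_mul (K : ℝ)))

theorem bzTargetBin_val {K : ℕ} (hK : 0 < K) {x : ℝ} (hx : x ≤ 1) :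
    (bzTargetBin hK x).val = ⌈K * x⌉₊ - 1 := by
  have : ⌈K * x⌉₊ ≤ K := Nat.ceil_le.2 (mul_le_of_le_one_right K.cast_nonneg hx)
  simp only [bzTargetBin]
  lia

/-- It translates the question "is `X ≤ j / K`?" into one about bins. It fails for `j = 0` and `x =
0`, hence the positivity of `j`. -/
theorem bzTargetBin_lt_iff {K : ℕ} (hK : 0 < K) {x : ℝ} (hx : x ≤ 1) {j : ℕ} (hj : 0 < j) :
    (bzTargetBin hK x).val < j ↔ x ≤ (j : ℝ) / K := by
  have hK' : (0 : ℝ) < K := by exact_mod_cast hK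
  rw [bzTargetBin_val hK hx, le_div_iff₀ hK', mul_comm x, ← Nat.ceil_le]
  lia

theorem le_bzTargetBin_add_one {K : ℕ} (hK : 0 < K) {x : ℝ} (hx : x ≤ 1) :
    x ≤ ((bzTargetBin hK x : ℝ) + 1) / K := by
  have := (bzTargetBin_lt_iff hK hx (Nat.succ_pos _)).1 (Nat.lt_succ_self (bzTargetBin hK x).val)
  simpa using this

theorem bzTargetBin_lt {K : ℕ} (hK : 0 < K) {x : ℝ} (h0 : 0 < x) (hx : x ≤ 1) :
    (bzTargetBin hK x : ℝ) / K < x := by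
  rcases Nat.eq_zero_or_pos (bzTargetBin hK x).val with h | h
  · simpa [h] using h0
  · by_contra! hc
    exact lt_irrefl _ ((bzTargetBin_lt_iff hK hx h).2 hc)

theorem bzTargetBin_le {K : ℕ} (hK : 0 < K) {x : ℝ} (h0 : 0 ≤ x) (hx : x ≤ 1) :
    (bzTargetBin hK x : ℝ) / K ≤ x := by
  rcases h0.eq_or_lt with rfl | h0
  · have : (bzTargetBin hK 0).val = 0 := by rw [bzTargetBin_val hK hx]; simp
    simp [this]
  · exact (bzTargetBin_lt hK h0 hx).le

theorem mem_bzBin_iff {K : ℕ} {z : ℝ} (hz : 0 < z) (i : Fin K) :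
    z ∈ bzBin K i ↔ z ∈ Set.Ioc ((i.val : ℝ) / K) (((i.val : ℝ) + 1) / K) := by
  unfold bzBin
  split_ifs with h
  · simp [h, hz, hz.le]
  · rfl

theorem bzDensity_eq {K : ℕ} (a : Fin K → ℝ) (i : Fin K) {z : ℝ}
    (hz : z ∈ Set.Ioc ((i.val : ℝ) / K) (((i.val : ℝ) + 1) / K)) : bzDensity a z = K * a i := by
  have hK : (0 : ℝ) < K := by exact_mod_cast i.pos
  have hz0 : 0 < z := lt_of_le_of_lt (by positivity) hz.1
  unfold bzDensity
  congr 1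
  rw [Finset.sum_eq_single i]
  · exact Set.indicator_of_mem ((mem_bzBin_iff hz0 i).2 hz) _
  · intro l _ hl
    refine Set.indicator_of_notMem (fun hzl => hl (Fin.ext ?_)) _
    rw [mem_bzBin_iff hz0] at hzl
    have h1 := hz.1.trans_le hzl.2
    have h2 := hzl.1.trans_le hz.2
    rw [div_lt_div_iff_of_pos_right hK] at h1 h2
    norm_cast at h1 h2
    lia
  · simp

theorem measurableSet_bzBin (K : ℕ) (i : Fin K) : MeasurableSet (bzBin K i) := by
  unfold bzBin
  split_ifs
  exacts [measurableSet_Icc, measurableSet_Ioc]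

theorem intervalIntegrable_bzDensity {K : ℕ} (a : Fin K → ℝ) (x y : ℝ) :
    IntervalIntegrable (bzDensity a) volume x y := by
  rw [intervalIntegrable_iff, Set.uIoc]
  refine Integrable.const_mul (integrable_finsetSum _ fun i _ => ?_) _
  exact (integrable_const _).indicator (measurableSet_bzBin K i)

theorem integral_bzDensity_bin {K : ℕ} (a : Fin K → ℝ) (i : Fin K) :
    ∫ z in ((i.val : ℝ) / K)..(((i.val : ℝ) + 1) / K), bzDensity a z = a i := by
  have hK : (0 : ℝ) < K := by exact_mod_cast i.pos
  have hle : (i.val : ℝ) / K ≤ ((i.val : ℝ) + 1) / K := by gcongr; linarith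
  have h : ∫ z in ((i.val : ℝ) / K)..(((i.val : ℝ) + 1) / K), bzDensity a z =
      ∫ _ in ((i.val : ℝ) / K)..(((i.val : ℝ) + 1) / K), K * a i := by
    refine intervalIntegral.integral_congr_ae (Filter.Eventually.of_forall fun z hz => ?_)
    rw [Set.uIoc_of_le hle] at hz
    exact bzDensity_eq a i hz
  rw [h, intervalIntegral.integral_const, smul_eq_mul]
  field_simp
  ring

theorem integral_bzDensity {K : ℕ} (a : Fin K → ℝ) (hK : 0 < K) :
    ∫ z in (0 : ℝ)..1, bzDensity a z = ∑ i, a i := by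
  have hK' : (K : ℝ) ≠ 0 := by positivity
  have h := intervalIntegral.sum_integral_adjacent_intervals (f := bzDensity a) (μ := volume)
    (a := fun k : ℕ => (k : ℝ) / K) (n := K) fun k _ => intervalIntegrable_bzDensity a _ _
  simp only [Nat.cast_zero, zero_div, div_self hK'] at h
  rw [← h, Finset.sum_range]
  refine Finset.sum_congr rfl fun i _ => ?_
  rw [← integral_bzDensity_bin a i]
  simp

theorem IsPosProb.bzDensity_pos {K : ℕ} {a : Fin K → ℝ} (ha : IsPosProb a) (hK : 0 < K) {z : ℝ}
    (h0 : 0 < z) (h1 : z ≤ 1) : 0 < bzDensity a z := by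
  rw [bzDensity_eq a (bzTargetBin hK z) ⟨bzTargetBin_lt hK h0 h1, le_bzTargetBin_add_one hK h1⟩]
  exact mul_pos (by exact_mod_cast hK) (ha.pos _)

theorem IsPosProb.integral_bzDensity_lt {K : ℕ} {a : Fin K → ℝ} (ha : IsPosProb a) (hK : 0 < K)
    {x y : ℝ} (h0 : 0 ≤ x) (hxy : x < y) (h1 : y ≤ 1) :
    ∫ z in (0 : ℝ)..x, bzDensity a z < ∫ z in (0 : ℝ)..y, bzDensity a z := by
  rw [← sub_pos, intervalIntegral.integral_interval_sub_left
    (intervalIntegrable_bzDensity a _ _) (intervalIntegrable_bzDensity a _ _)]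
  exact intervalIntegral.intervalIntegral_pos_of_pos_on (intervalIntegrable_bzDensity a _ _)
    (fun z hz => ha.bzDensity_pos hK (h0.trans_lt hz.1) (hz.2.le.trans h1)) hxy

/-- A bin with at least half of the mass contains the median in its closure. -/
theorem IsPosProb.bzMedian_mem {K : ℕ} {a : Fin K → ℝ} (ha : IsPosProb a) {i : Fin K}
    (hi : 1 / 2 ≤ a i) :
    bzMedian a ∈ Set.Icc ((i.val : ℝ) / K) (((i.val : ℝ) + 1) / K) := by
  have hK := i.pos
  have hK' : (0 : ℝ) < K := by exact_mod_cast hK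
  have hle : (i.val : ℝ) / K < ((i.val : ℝ) + 1) / K := by gcongr; linarith
  have h1 : ((i.val : ℝ) + 1) / K ≤ 1 := by
    rw [div_le_one hK']
    exact_mod_cast i.isLt
  have h0 : 0 ≤ (i.val : ℝ) / K := by positivity
  have hbin := integral_bzDensity_bin a i
  rw [← intervalIntegral.integral_interval_sub_left (a := 0)
    (intervalIntegrable_bzDensity a _ _) (intervalIntegrable_bzDensity a _ _)] at hbin
  have hmono : ∀ {x y : ℝ}, 0 ≤ x → x ≤ y → y ≤ 1 →
      ∫ z in (0 : ℝ)..x, bzDensity a z ≤ ∫ z in (0 : ℝ)..y, bzDensity a z := by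
    intro x y hx hxy hy
    rcases hxy.eq_or_lt with rfl | hxy
    exacts [le_rfl, (ha.integral_bzDensity_lt hK hx hxy hy).le]
  have htot := hmono (h0.trans hle.le) h1 le_rfl
  rw [integral_bzDensity a hK, ha.sum_eq] at htot
  have hnn := hmono le_rfl h0 (hle.le.trans h1)
  rw [intervalIntegral.integral_same] at hnn
  have hmem : ((i.val : ℝ) + 1) / K ∈
      {x : ℝ | 0 ≤ x ∧ x ≤ 1 ∧ 1 / 2 ≤ ∫ z in (0 : ℝ)..x, bzDensity a z} :=
    ⟨h0.trans hle.le, h1, by linarith⟩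
  -- The mass left of the bin is at most `1/2`, and the distribution function increases strictly, so
  -- no point before the bin reaches `1/2`; the right end point does.
  refine ⟨le_csInf ⟨_, hmem⟩ ?_, csInf_le ⟨0, fun x hx => hx.1⟩ hmem⟩
  rintro x ⟨hx0, -, hx⟩
  by_contra! hlt
  have := ha.integral_bzDensity_lt hK hx0 hlt (hle.le.trans h1)
  linarith

theorem bzMedian_mem_unit {K : ℕ} (a : Fin K → ℝ) : bzMedian a ∈ Set.Icc (0 : ℝ) 1 := by
  unfold bzMedian
  rcases Set.eq_empty_or_nonempty
    {x : ℝ | 0 ≤ x ∧ x ≤ 1 ∧ 1 / 2 ≤ ∫ z in (0 : ℝ)..x, bzDensity a z} with h | ⟨x, hx⟩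
  · rw [h, Real.sInf_empty]
    simp
  · exact ⟨le_csInf ⟨x, hx⟩ fun y hy => hy.1, (csInf_le ⟨0, fun y hy => hy.1⟩ hx).trans hx.2.1⟩

theorem IsPosProb.abs_sub_bzMedian_le {K : ℕ} {a : Fin K → ℝ} (ha : IsPosProb a) (hK : 0 < K)
    {x : ℝ} (h0 : 0 ≤ x) (h1 : x ≤ 1) (h : 1 / 2 ≤ a (bzTargetBin hK x)) :
    |x - bzMedian a| ≤ 1 / K := by
  obtain ⟨h2, h3⟩ := ha.bzMedian_mem h
  have h4 := bzTargetBin_le hK h0 h1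
  have h5 := le_bzTargetBin_add_one hK h1
  rw [add_div] at h3 h5
  rw [abs_le]
  constructor <;> linarith

/-! ### The posterior as a function of the history -/

section Posterior

variable {M : ℕ} [NeZero M] {ε : Fin M → ℝ} {K : ℕ}

theorem isPosProb_bzPosterior (hε : ∀ m, 0 < ε m ∧ ε m < 1 / 2) (hK : 0 < K) (q : ℕ → ℕ)
    (y : ℕ → Bool) (t : ℕ) : IsPosProb (bzPosterior ε K q y t) := by
  induction t with
  | zero => exact isPosProb_uniform hK
  | succ t ih =>
    obtain ⟨h0, h1⟩ := hε (Fin.ofNat M t)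
    exact ih.bzUpdate_isPosProb (bzAlpha_pos h0) (by linarith [bzAlpha_le_half h0 h1]) _ _

/-- The posterior masses after `t` questions are bounded below. -/
theorem exists_forall_le_bzPosterior (hε : ∀ m, 0 < ε m ∧ ε m < 1 / 2) (hK : 0 < K) (t : ℕ) :
    ∃ c > 0, ∀ q y i, c ≤ bzPosterior ε K q y t i := by
  induction t with
  | zero => exact ⟨1 / K, by positivity, fun q y i => le_rfl⟩
  | succ t ih =>
    obtain ⟨c, hc, h⟩ := ih
    obtain ⟨h0, h1⟩ := hε (Fin.ofNat M t)
    have hα := bzAlpha_pos h0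
    refine ⟨_, mul_pos hα hc, fun q y i => ?_⟩
    exact (mul_le_mul_of_nonneg_left (h q y i) hα.le).trans
      ((isPosProb_bzPosterior hε hK q y t).le_bzUpdate hα (bzAlpha_le_half h0 h1) _ _ _)

theorem bzPosterior_congr {q q' : ℕ → ℕ} {y y' : ℕ → Bool} {t : ℕ} (hq : ∀ s < t, q s = q' s)
    (hy : ∀ s < t, y s = y' s) : bzPosterior ε K q y t = bzPosterior ε K q' y' t := by
  induction t with
  | zero => rfl
  | succ t ih =>
    rw [bzPosterior, bzPosterior, hq t t.lt_succ_self, hy t t.lt_succ_self,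
      ih (fun s hs => hq s (hs.trans t.lt_succ_self)) fun s hs => hy s (hs.trans t.lt_succ_self)]

variable {Ω : Type*} {Q : ℕ → Ω → ℕ} {Y : ℕ → Ω → Bool}

/-- Every function of the posterior after `t` questions, and of further discrete data, is measurable
with respect to the information of the controller and these data. -/
theorem measurable_bzPosterior_comp {m : MeasurableSpace Ω} {t : ℕ} (hm : bzInfo Q Y t ≤ m)
    {γ : Type*} [MeasurableSpace γ] [Countable γ] [DiscreteMeasurableSpace γ] {Z : Ω → γ}
    (hZ : Measurable[m] Z) {β : Type*} [MeasurableSpace β] (φ : (Fin K → ℝ) → γ → β) :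
    Measurable[m] fun ω => φ (bzPosterior ε K (fun s => Q s ω) (fun s => Y s ω) t) (Z ω) := by
  -- The posterior factors through the first `t` query-answer pairs, a countable discrete space on
  -- which every function is measurable. The defaults `0` and `false` are never read.
  let g : (Fin t → ℕ × Bool) → Fin K → ℝ := fun h =>
    bzPosterior ε K (fun s => if hs : s < t then (h ⟨s, hs⟩).1 else 0)
      (fun s => if hs : s < t then (h ⟨s, hs⟩).2 else false) t
  let H : Ω → Fin t → ℕ × Bool := fun ω s => (Q s ω, Y s ω)
  have hle : ∀ s < t, MeasurableSpace.comap (Q s) inferInstance ⊔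
      MeasurableSpace.comap (Y s) inferInstance ≤ m := fun s hs =>
    (le_iSup₂_of_le (f := fun s (_ : s < t) => MeasurableSpace.comap (Q s) inferInstance ⊔
      MeasurableSpace.comap (Y s) inferInstance) s hs le_rfl).trans hm
  have hH : Measurable[m] H := by
    refine measurable_pi_iff.2 fun s => Measurable.prodMk ?_ ?_
    · exact measurable_iff_comap_le.2 (le_sup_left.trans (hle s s.2))
    · exact measurable_iff_comap_le.2 (le_sup_right.trans (hle s s.2))
  have heq : (fun ω => φ (bzPosterior ε K (fun s => Q s ω) (fun s => Y s ω) t) (Z ω)) =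
      (fun p : (Fin t → ℕ × Bool) × γ => φ (g p.1) p.2) ∘ fun ω => (H ω, Z ω) := by
    funext ω
    simp only [Function.comp, g, H]
    congr 1
    exact bzPosterior_congr (fun s hs => by simp [hs]) fun s hs => by simp [hs]
  rw [heq]
  exact Measurable.of_discrete.comp (hH.prodMk hZ)

end Posterior

/-! ### Conditional probabilities and auxiliary bounds -/

/-- Integrating a bounded `m`-measurable function over a set means weighting it with the
conditional probability of the set. -/
theorem integral_indicator_eq_integral_condProb_mul {Ω : Type*} {m m0 : MeasurableSpace Ω}
    (hm : m ≤ m0) {μ : Measure Ω} [IsProbabilityMeasure μ] {A : Set Ω} (hA : MeasurableSet A)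
    {f p : Ω → ℝ} (hf : Measurable[m] f) {C : ℝ} (hC : ∀ ω, |f ω| ≤ C) (hp : μ⟦A | m⟧ =ᵐ[μ] p) :
    ∫ ω, A.indicator f ω ∂μ = ∫ ω, f ω * p ω ∂μ := by
  have hint : Integrable (A.indicator fun _ => (1 : ℝ)) μ := (integrable_const _).indicator hA
  have h := condExp_stronglyMeasurable_mul_of_bound hm hf.stronglyMeasurable hint C
    (Filter.Eventually.of_forall hC)
  have h1 : A.indicator f = f * A.indicator fun _ => (1 : ℝ) := by
    funext ω
    by_cases hω : ω ∈ A <;> simp [hω]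
  rw [h1, ← integral_condExp hm]
  refine integral_congr_ae ?_
  filter_upwards [h, hp] with ω h2 h3
  rw [h2, Pi.mul_apply, h3]

theorem IsPosProb.apply_le_one {K : ℕ} {a : Fin K → ℝ} (ha : IsPosProb a) (i : Fin K) :
    a i ≤ 1 :=
  ha.sum_eq ▸ Finset.single_le_sum (fun l _ => (ha.pos l).le) (Finset.mem_univ i)

theorem abs_one_div_sub_one_le {x c : ℝ} (hc : 0 < c) (hx : c ≤ x) :
    |1 / x - 1| ≤ 1 / c + 1 := by
  have h1 : 1 / x ≤ 1 / c := one_div_le_one_div_of_le hc hx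
  have h2 : 0 < 1 / x := one_div_pos.2 (hc.trans_le hx)
  rw [abs_le]
  constructor <;> linarith

theorem IsPosProb.abs_bzAnswerMean_le {K : ℕ} {a : Fin K → ℝ} (ha : IsPosProb a) (e : ℝ)
    (θ : Fin K) (j : ℕ) {c : ℝ} (hc : 0 < c) (h : c ≤ a θ) :
    |bzAnswerMean e a θ j| ≤ 1 / c + 1 := by
  obtain ⟨hS0, hS1⟩ := ha.bzSideMass_mem θ j
  have hr := two_mul_sqrt_mul_le_one e
  have hr0 := Real.sqrt_nonneg (e * (1 - e))
  have h0 : 0 ≤ bzSideMass a θ j + (1 - bzSideMass a θ j) * (2 * √(e * (1 - e))) := by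
    have := mul_nonneg (sub_nonneg.2 hS1) (mul_nonneg zero_le_two hr0)
    linarith
  have h1 : bzSideMass a θ j + (1 - bzSideMass a θ j) * (2 * √(e * (1 - e))) ≤ 1 := by
    have := mul_le_mul_of_nonneg_left hr (sub_nonneg.2 hS1)
    linarith
  have h2 : (bzSideMass a θ j + (1 - bzSideMass a θ j) * (2 * √(e * (1 - e)))) / a θ ≤ 1 / c :=
    div_le_div₀ zero_le_one h1 hc h
  have h3 := div_nonneg h0 (hc.trans_le h).le
  unfold bzAnswerMean
  rw [abs_le]
  constructor <;> linarith [one_div_pos.2 hc]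

theorem sum_range_mul_ofNat {M : ℕ} [NeZero M] (f : Fin M → ℝ) (n : ℕ) :
    ∑ t ∈ Finset.range (n * M), f (Fin.ofNat M t) = n * ∑ m, f m := by
  induction n with
  | zero => simp
  | succ n ih =>
    rw [Nat.succ_mul, Finset.sum_range_add, ih, Finset.sum_range, Nat.cast_succ, add_one_mul]
    congr 1
    refine Finset.sum_congr rfl fun i _ => congrArg f (Fin.ext ?_)
    simp [Fin.ofNat, Nat.mod_eq_of_lt i.isLt]

/-! ### Decay of the expected odds and the failure probability -/

namespace IsBZRun

variable {M : ℕ} [NeZero M] {ε : Fin M → ℝ} {K : ℕ} {Ω : Type*} {X : Ω → ℝ} {Q : ℕ → Ω → ℕ}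
  {Y : ℕ → Ω → Bool}

/-- The potential: the posterior odds against the bin of the target. -/
noncomputable def odds (ε : Fin M → ℝ) (hK : 0 < K) (X : Ω → ℝ) (Q : ℕ → Ω → ℕ) (Y : ℕ → Ω → Bool)
    (t : ℕ) (ω : Ω) : ℝ :=
  1 / bzPosterior ε K (fun s => Q s ω) (fun s => Y s ω) t (bzTargetBin hK (X ω)) - 1

theorem odds_nonneg (hε : ∀ m, 0 < ε m ∧ ε m < 1 / 2) (hK : 0 < K) (t : ℕ) (ω : Ω) :
    0 ≤ odds ε hK X Q Y t ω := by
  have ha := isPosProb_bzPosterior hε hK (fun s => Q s ω) (fun s => Y s ω) t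
  exact sub_nonneg.2 ((one_le_div (ha.pos _)).2 (ha.apply_le_one _))

variable [mΩ : MeasurableSpace Ω] {μ : Measure Ω}

theorem bzInfo_le (hrun : IsBZRun μ ε K X Q Y) (t : ℕ) : bzInfo Q Y t ≤ mΩ :=
  iSup₂_le fun s _ => sup_le (hrun.measurable_query s).comap_le (hrun.measurable_answer s).comap_le

theorem bzInfo_sup_le (hrun : IsBZRun μ ε K X Q Y) (t : ℕ) :
    bzInfo Q Y t ⊔ MeasurableSpace.comap X inferInstance ≤ mΩ :=
  sup_le (hrun.bzInfo_le t) hrun.measurable_target.comap_le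

theorem bzInfo_sup_sup_le (hrun : IsBZRun μ ε K X Q Y) (t : ℕ) :
    (bzInfo Q Y t ⊔ MeasurableSpace.comap X inferInstance) ⊔
      MeasurableSpace.comap (Q t) inferInstance ≤ mΩ :=
  sup_le (hrun.bzInfo_sup_le t) (hrun.measurable_query t).comap_le

/-- The coin gives no weight to grid points beyond `K`; thus the average over the query becomes a
finite sum. -/
theorem ae_query_le [IsProbabilityMeasure μ] (hrun : IsBZRun μ ε K X Q Y)
    (hε : ∀ m, 0 < ε m ∧ ε m < 1 / 2) (hK : 0 < K) (t : ℕ) : ∀ᵐ ω ∂μ, Q t ω ≤ K := by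
  have h : ∀ j, K < j → ∀ᵐ ω ∂μ, Q t ω ≠ j := by
    intro j hj
    have hA : MeasurableSet {ω | Q t ω = j} := hrun.measurable_query t (measurableSet_singleton j)
    have h1 := integral_indicator_eq_integral_condProb_mul (hrun.bzInfo_sup_le t) hA
      (f := fun _ => 1) measurable_const (C := 1) (by simp) (hrun.query_law t j)
    simp only [(isPosProb_bzPosterior hε hK _ _ t).bzQueryProb_of_gt hj, mul_zero,
      integral_zero] at h1
    rw [integral_indicator hA, setIntegral_const, smul_eq_mul, mul_one] at h1
    rw [measureReal_eq_zero_iff] at h1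
    exact measure_eq_zero_iff_ae_notMem.1 h1
  filter_upwards [ae_all_iff.2 fun j => ae_all_iff.2 (h j)] with ω hω
  by_contra! hlt
  exact hω _ hlt rfl

theorem integrable_odds [IsProbabilityMeasure μ] (hrun : IsBZRun μ ε K X Q Y)
    (hε : ∀ m, 0 < ε m ∧ ε m < 1 / 2) (hK : 0 < K) (t : ℕ) : Integrable (odds ε hK X Q Y t) μ := by
  obtain ⟨c, hc, h⟩ := exists_forall_le_bzPosterior hε hK t
  have hmeas : Measurable (odds ε hK X Q Y t) :=
    measurable_bzPosterior_comp (hrun.bzInfo_le t)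
      ((measurable_bzTargetBin hK).comp hrun.measurable_target) fun a θ => 1 / a θ - 1
  exact Integrable.of_bound hmeas.aestronglyMeasurable (1 / c + 1)
    (Filter.Eventually.of_forall fun ω => abs_one_div_sub_one_le hc (h _ _ _))

/-- The new odds equal `f false + 1_A (f true - f false)`, with `A` the event of a yes and `f b` the
odds after answer `b`. Both `f b` are known before the answer, so `1_A` may be replaced by its
conditional probability. -/
theorem integral_odds_succ_eq [IsProbabilityMeasure μ] (hrun : IsBZRun μ ε K X Q Y)
    (hε : ∀ m, 0 < ε m ∧ ε m < 1 / 2) (hK : 0 < K) (t : ℕ) :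
    ∫ ω, odds ε hK X Q Y (t + 1) ω ∂μ =
      ∫ ω, bzAnswerMean (ε (Fin.ofNat M t)) (bzPosterior ε K (fun s => Q s ω) (fun s => Y s ω) t)
        (bzTargetBin hK (X ω)) (Q t ω) ∂μ := by
  obtain ⟨h0, h1⟩ := hε (Fin.ofNat M t)
  obtain ⟨c, hc, hcb⟩ := exists_forall_le_bzPosterior hε hK t
  have hα := bzAlpha_pos h0
  let f : Bool → Ω → ℝ := fun b ω => 1 / bzUpdate (bzAlpha (ε (Fin.ofNat M t)))
    (bzPosterior ε K (fun s => Q s ω) (fun s => Y s ω) t) (Q t ω) b (bzTargetBin hK (X ω)) - 1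
  let A : Set Ω := {ω | Y t ω = true}
  have hA : MeasurableSet A := hrun.measurable_answer t (measurableSet_singleton true)
  have hm := hrun.bzInfo_sup_sup_le t
  have hf : ∀ b, Measurable[(bzInfo Q Y t ⊔ MeasurableSpace.comap X inferInstance) ⊔
      MeasurableSpace.comap (Q t) inferInstance] (f b) := by
    intro b
    have hQm : Measurable[(bzInfo Q Y t ⊔ MeasurableSpace.comap X inferInstance) ⊔
        MeasurableSpace.comap (Q t) inferInstance] (Q t) := measurable_iff_comap_le.2 le_sup_right
    have hXm : Measurable[(bzInfo Q Y t ⊔ MeasurableSpace.comap X inferInstance) ⊔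
        MeasurableSpace.comap (Q t) inferInstance] X :=
      measurable_iff_comap_le.2 (le_sup_right.trans le_sup_left)
    exact measurable_bzPosterior_comp (ε := ε) (Q := Q) (Y := Y) (t := t)
      (le_sup_left.trans le_sup_left) (hQm.prodMk ((measurable_bzTargetBin hK).comp hXm))
      fun a z => 1 / bzUpdate (bzAlpha (ε (Fin.ofNat M t))) a z.1 b z.2 - 1
  have hfb : ∀ b ω, |f b ω| ≤ 1 / (bzAlpha (ε (Fin.ofNat M t)) * c) + 1 := fun b ω =>
    abs_one_div_sub_one_le (mul_pos hα hc) <|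
      (mul_le_mul_of_nonneg_left (hcb _ _ _) hα.le).trans
        ((isPosProb_bzPosterior hε hK _ _ t).le_bzUpdate hα (bzAlpha_le_half h0 h1) _ _ _)
  have hfi : ∀ b, Integrable (f b) μ := fun b =>
    Integrable.of_bound ((hf b).mono hm le_rfl).aestronglyMeasurable _
      (Filter.Eventually.of_forall (hfb b))
  let p : Ω → ℝ := fun ω =>
    if X ω ≤ (Q t ω : ℝ) / K then 1 - ε (Fin.ofNat M t) else ε (Fin.ofNat M t)
  have hpm : Measurable p := by
    refine Measurable.ite ?_ measurable_const measurable_const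
    exact measurableSet_le hrun.measurable_target
      (((Measurable.of_discrete (f := fun n : ℕ => (n : ℝ))).comp
        (hrun.measurable_query t)).div_const _)
  have hstep := integral_indicator_eq_integral_condProb_mul hm hA (f := f true - f false)
    ((hf true).sub (hf false)) (C := 2 * (1 / (bzAlpha (ε (Fin.ofNat M t)) * c) + 1))
    (fun ω => by
      have := abs_sub (f true ω) (f false ω)
      have h2 := hfb true ω
      have h3 := hfb false ω
      rw [Pi.sub_apply]
      linarith) (hrun.answer_law t)
  have hpi : Integrable (fun ω => (f true - f false) ω * p ω) μ := by
    refine ((hfi true).sub (hfi false)).mul_bdd (c := 1) hpm.aestronglyMeasurable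
      (Filter.Eventually.of_forall fun ω => ?_)
    simp only [p, Real.norm_eq_abs]
    split_ifs <;> rw [abs_le] <;> constructor <;> linarith
  calc ∫ ω, odds ε hK X Q Y (t + 1) ω ∂μ
      = ∫ ω, (A.indicator (f true - f false) ω + f false ω) ∂μ := by
        refine integral_congr_ae (Filter.Eventually.of_forall fun ω => ?_)
        by_cases hω : Y t ω = true
        · have : ω ∈ A := hω
          simp [this, odds, bzPosterior, f, hω]
        · have : ω ∉ A := hω
          rw [Bool.not_eq_true] at hω
          simp [this, odds, bzPosterior, f, hω]
    _ = ∫ ω, ((f true - f false) ω * p ω + f false ω) ∂μ := by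
        rw [integral_add (((hfi true).sub (hfi false)).indicator hA) (hfi false), hstep,
          integral_add hpi (hfi false)]
    _ = _ := by
        refine integral_congr_ae ?_
        filter_upwards [hrun.target_mem] with ω hω
        rw [← (isPosProb_bzPosterior hε hK _ _ t).answer_step h0 h1 (p := p ω)]
        · simp only [Pi.sub_apply, f]
          ring
        · intro hj
          simp only [p, bzTargetBin_lt_iff hK hω.2 hj]

theorem integral_odds_succ_le [IsProbabilityMeasure μ] (hrun : IsBZRun μ ε K X Q Y)
    (hε : ∀ m, 0 < ε m ∧ ε m < 1 / 2) (hK : 0 < K) (t : ℕ) :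
    ∫ ω, odds ε hK X Q Y (t + 1) ω ∂μ ≤
      (1 / 2 + √(ε (Fin.ofNat M t) * (1 - ε (Fin.ofNat M t)))) *
        ∫ ω, odds ε hK X Q Y t ω ∂μ := by
  obtain ⟨h0, h1⟩ := hε (Fin.ofNat M t)
  obtain ⟨c, hc, hcb⟩ := exists_forall_le_bzPosterior hε hK t
  set e := ε (Fin.ofNat M t)
  let a : Ω → Fin K → ℝ := fun ω => bzPosterior ε K (fun s => Q s ω) (fun s => Y s ω) t
  have ha : ∀ ω, IsPosProb (a ω) := fun ω => isPosProb_bzPosterior hε hK _ _ t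
  let φ : ℕ → Ω → ℝ := fun j ω => bzAnswerMean e (a ω) (bzTargetBin hK (X ω)) j
  have hm := hrun.bzInfo_sup_le t
  have hφ : ∀ j, Measurable[bzInfo Q Y t ⊔ MeasurableSpace.comap X inferInstance] (φ j) :=
    fun j => measurable_bzPosterior_comp le_sup_left
      ((measurable_bzTargetBin hK).comp (measurable_iff_comap_le.2 le_sup_right))
      fun a θ => bzAnswerMean e a θ j
  have hφb : ∀ j ω, |φ j ω| ≤ 1 / c + 1 := fun j ω =>
    (ha ω).abs_bzAnswerMean_le e _ j hc (hcb _ _ _)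
  have hφi : ∀ j, Integrable (φ j) μ := fun j =>
    Integrable.of_bound ((hφ j).mono hm le_rfl).aestronglyMeasurable _
      (Filter.Eventually.of_forall (hφb j))
  have hB : ∀ j, MeasurableSet {ω | Q t ω = j} := fun j =>
    hrun.measurable_query t (measurableSet_singleton j)
  -- The coin probability agrees almost surely with a conditional expectation, which supplies
  -- integrability.
  have hqi : ∀ j, Integrable (fun ω => φ j ω * bzQueryProb (a ω) j) μ := by
    intro j
    have hint : Integrable (fun ω => φ j ω *
        (μ⟦{ω | Q t ω = j} | bzInfo Q Y t ⊔ MeasurableSpace.comap X inferInstance⟧) ω) μ :=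
      integrable_condExp.bdd_mul ((hφ j).mono hm le_rfl).aestronglyMeasurable
        (Filter.Eventually.of_forall (hφb j))
    refine hint.congr ?_
    filter_upwards [hrun.query_law t j] with ω hω
    rw [hω]
  rw [hrun.integral_odds_succ_eq hε hK t, ← integral_const_mul]
  calc ∫ ω, bzAnswerMean e (a ω) (bzTargetBin hK (X ω)) (Q t ω) ∂μ
      = ∫ ω, ∑ j ∈ Finset.range (K + 1), {ω | Q t ω = j}.indicator (φ j) ω ∂μ := by
        refine integral_congr_ae ?_
        filter_upwards [hrun.ae_query_le hε hK t] with ω hω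
        rw [Finset.sum_eq_single (Q t ω)]
        · simp [φ]
        · intro j _ hj
          exact Set.indicator_of_notMem (fun h => hj h.symm) _
        · intro h
          exact absurd (Finset.mem_range.2 (by lia)) h
    _ = ∫ ω, ∑ j ∈ Finset.range (K + 1), φ j ω * bzQueryProb (a ω) j ∂μ := by
        rw [integral_finsetSum _ fun j _ => (hφi j).indicator (hB j),
          integral_finsetSum _ fun j _ => hqi j]
        exact Finset.sum_congr rfl fun j _ => integral_indicator_eq_integral_condProb_mul hm (hB j)
          (hφ j) (hφb j) (hrun.query_law t j)
    _ ≤ _ := by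
        refine integral_mono (integrable_finsetSum _ fun j _ => hqi j)
          ((hrun.integrable_odds hε hK t).const_mul _) fun ω => ?_
        refine le_of_eq_of_le (Finset.sum_congr rfl fun j _ => mul_comm _ _) ?_
        exact (ha ω).query_step h0 h1 _

theorem integral_odds_le [IsProbabilityMeasure μ] (hrun : IsBZRun μ ε K X Q Y)
    (hε : ∀ m, 0 < ε m ∧ ε m < 1 / 2) (hK : 0 < K) (t : ℕ) :
    ∫ ω, odds ε hK X Q Y t ω ∂μ ≤ ((K : ℝ) - 1) * Real.exp (-∑ s ∈ Finset.range t,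
      (1 / 2 - √(ε (Fin.ofNat M s) * (1 - ε (Fin.ofNat M s))))) := by
  induction t with
  | zero => simp [odds, bzPosterior]
  | succ t ih =>
    have h := hrun.integral_odds_succ_le hε hK t
    have hnn : 0 ≤ ∫ ω, odds ε hK X Q Y t ω ∂μ := integral_nonneg fun ω => odds_nonneg hε hK t ω
    set r := √(ε (Fin.ofNat M t) * (1 - ε (Fin.ofNat M t)))
    -- This is `1 - x ≤ exp (-x)` at `x = 1/2 - r`.
    have hexp : 1 / 2 + r ≤ Real.exp (-(1 / 2 - r)) := by
      have := Real.add_one_le_exp (-(1 / 2 - r))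
      linarith
    rw [Finset.sum_range_succ, neg_add, Real.exp_add, ← mul_assoc]
    calc _ ≤ Real.exp (-(1 / 2 - r)) * ∫ ω, odds ε hK X Q Y t ω ∂μ :=
          h.trans (mul_le_mul_of_nonneg_right hexp hnn)
      _ ≤ _ := by
          rw [mul_comm]
          exact mul_le_mul_of_nonneg_right ih (Real.exp_pos _).le

theorem measureReal_estimate_gt_le [IsProbabilityMeasure μ] (hrun : IsBZRun μ ε K X Q Y)
    (hε : ∀ m, 0 < ε m ∧ ε m < 1 / 2) (hK : 0 < K) (n : ℕ) :
    μ.real {ω | 1 / (K : ℝ) < |X ω - bzEstimate ε K (fun t => Q t ω) (fun t => Y t ω) n|} ≤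
      ((K : ℝ) - 1) * Real.exp (-(n * bzRate ε)) := by
  have hmarkov := mul_meas_ge_le_integral_of_nonneg
    (Filter.Eventually.of_forall fun ω => odds_nonneg hε hK (n * M) ω)
    (hrun.integrable_odds hε hK (n * M)) 1
  have hbound := hrun.integral_odds_le hε hK (n * M)
  rw [sum_range_mul_ofNat (fun m => 1 / 2 - √(ε m * (1 - ε m)))] at hbound
  refine le_trans ?_ (hmarkov.trans hbound)
  rw [one_mul]
  refine ENNReal.toReal_mono (measure_ne_top _ _) (measure_mono_ae ?_)
  filter_upwards [hrun.target_mem] with ω hω h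
  have ha := isPosProb_bzPosterior hε hK (fun s => Q s ω) (fun s => Y s ω) (n * M)
  have hlt : bzPosterior ε K (fun s => Q s ω) (fun s => Y s ω) (n * M)
      (bzTargetBin hK (X ω)) < 1 / 2 := by
    by_contra! hle
    exact absurd (ha.abs_sub_bzMedian_le hK hω.1 hω.2 hle) (not_le.2 h)
  have h2 : 2 ≤ 1 / bzPosterior ε K (fun s => Q s ω) (fun s => Y s ω) (n * M)
      (bzTargetBin hK (X ω)) := by
    rw [le_div_iff₀ (ha.pos _)]
    linarith
  change 1 ≤ odds ε hK X Q Y (n * M) ω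
  unfold odds
  linarith

/-! ### The mean squared error -/

theorem measurable_estimate (hrun : IsBZRun μ ε K X Q Y) (n : ℕ) :
    Measurable fun ω => bzEstimate ε K (fun t => Q t ω) (fun t => Y t ω) n :=
  measurable_bzPosterior_comp (hrun.bzInfo_le (n * M)) (Z := fun _ => ()) measurable_const
    fun a _ => bzMedian a

theorem ae_sq_error_le_one (hrun : IsBZRun μ ε K X Q Y) (n : ℕ) :
    ∀ᵐ ω ∂μ, (X ω - bzEstimate ε K (fun t => Q t ω) (fun t => Y t ω) n) ^ 2 ≤ 1 := by
  filter_upwards [hrun.target_mem] with ω hω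
  obtain ⟨h0, h1⟩ := bzMedian_mem_unit (bzPosterior ε K (fun s => Q s ω) (fun s => Y s ω) (n * M))
  rw [sq_le_one_iff_abs_le_one, abs_le, bzEstimate]
  constructor <;> linarith [hω.1, hω.2]

theorem integrable_sq_error [IsProbabilityMeasure μ] (hrun : IsBZRun μ ε K X Q Y) (n : ℕ) :
    Integrable (fun ω => (X ω - bzEstimate ε K (fun t => Q t ω) (fun t => Y t ω) n) ^ 2) μ := by
  refine Integrable.of_bound
    ((hrun.measurable_target.sub (hrun.measurable_estimate n)).pow_const 2).aestronglyMeasurable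
    1 ?_
  filter_upwards [hrun.ae_sq_error_le_one n] with ω hω
  rwa [Real.norm_of_nonneg (sq_nonneg _)]

theorem integral_sq_error_le [IsProbabilityMeasure μ] (hrun : IsBZRun μ ε K X Q Y)
    (hε : ∀ m, 0 < ε m ∧ ε m < 1 / 2)
    (hK : 0 < K) (n : ℕ) :
    ∫ ω, (X ω - bzEstimate ε K (fun t => Q t ω) (fun t => Y t ω) n) ^ 2 ∂μ ≤
      (1 / (K : ℝ)) ^ 2 + ((K : ℝ) - 1) * Real.exp (-(n * bzRate ε)) := by
  let A : Set Ω :=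
    {ω | 1 / (K : ℝ) < |X ω - bzEstimate ε K (fun t => Q t ω) (fun t => Y t ω) n|}
  have hA : MeasurableSet A :=
    measurableSet_lt measurable_const (hrun.measurable_target.sub (hrun.measurable_estimate n)).abs
  have hint : Integrable (A.indicator fun _ => (1 : ℝ)) μ := (integrable_const _).indicator hA
  calc _ ≤ ∫ ω, ((1 / (K : ℝ)) ^ 2 + A.indicator (fun _ => (1 : ℝ)) ω) ∂μ := by
        refine integral_mono_ae (hrun.integrable_sq_error n) ((integrable_const _).add hint) ?_
        filter_upwards [hrun.ae_sq_error_le_one n] with ω hω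
        by_cases h : ω ∈ A
        · rw [Set.indicator_of_mem h]
          linarith [sq_nonneg (1 / (K : ℝ))]
        · rw [Set.indicator_of_notMem h, add_zero]
          exact sq_le_sq' (abs_le.1 (not_lt.1 h)).1 (abs_le.1 (not_lt.1 h)).2
    _ = (1 / (K : ℝ)) ^ 2 + μ.real A := by
        rw [integral_add (integrable_const _) hint, integral_indicator hA, setIntegral_const,
          integral_const]
        simp
    _ ≤ _ := add_le_add_right (hrun.measureReal_estimate_gt_le hε hK n) _

end IsBZRun

/-- The choice `K = ⌈2^(1/3) e^(x/3)⌉` balances discretization error and failure probability. -/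
theorem sq_one_div_add_le_of_eq_ceil {K : ℕ} {x : ℝ}
    (hK : K = ⌈(2 : ℝ) ^ (1 / 3 : ℝ) * Real.exp (x / 3)⌉₊) :
    (1 / (K : ℝ)) ^ 2 + ((K : ℝ) - 1) * Real.exp (-x) ≤
      ((2 : ℝ) ^ (-(2 / 3) : ℝ) + (2 : ℝ) ^ (1 / 3 : ℝ)) * Real.exp (-(2 / 3 * x)) := by
  set A : ℝ := (2 : ℝ) ^ (1 / 3 : ℝ) * Real.exp (x / 3)
  have hA : 0 < A := by positivity
  have h1 : A ≤ K := hK ▸ Nat.le_ceil A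
  -- `A` minimizes `1 / A ^ 2 + A * exp (-x)`, as `A ^ 3 = 2 * exp x`. Rounding up costs nothing:
  -- the first term needs only `A ≤ K`, the second only `K - 1 ≤ A`.
  have h2 : (K : ℝ) - 1 ≤ A := by
    have := Nat.ceil_lt_add_one hA.le
    rw [← hK] at this
    linarith
  have h3 : (1 / A) ^ 2 = (2 : ℝ) ^ (-(2 / 3) : ℝ) * Real.exp (-(2 / 3 * x)) := by
    rw [one_div, inv_pow, mul_pow, mul_inv, Real.rpow_neg zero_le_two, Real.exp_neg,
      ← Real.rpow_natCast, ← Real.rpow_mul zero_le_two, ← Real.exp_nat_mul]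
    congr 3
    · norm_num
    · push_cast
      ring
  have h4 : A * Real.exp (-x) = (2 : ℝ) ^ (1 / 3 : ℝ) * Real.exp (-(2 / 3 * x)) := by
    rw [mul_assoc, ← Real.exp_add]
    congr 2
    ring
  rw [add_mul, ← h3, ← h4]
  have h5 : 1 / (K : ℝ) ≤ 1 / A := one_div_le_one_div_of_le hA h1
  gcongr

theorem theorem5 {M : ℕ} [NeZero M] (ε : Fin M → ℝ) (hε : ∀ m, 0 < ε m ∧ ε m < 1 / 2)
    {Ω : Type*} [MeasurableSpace Ω] (μ : Measure Ω) [IsProbabilityMeasure μ]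
    (K : ℕ) (hK : 0 < K) (Δ : ℝ) (hΔ : Δ = 1 / (K : ℝ))
    (X : Ω → ℝ) (Q : ℕ → Ω → ℕ) (Y : ℕ → Ω → Bool) (hrun : IsBZRun μ ε K X Q Y)
    (Xhat : ℕ → Ω → ℝ)
    (hXhat : ∀ n ω, Xhat n ω = bzEstimate ε K (fun t => Q t ω) (fun t => Y t ω) n) :
    (∀ n : ℕ, μ.real {ω | Δ < |X ω - Xhat n ω|} ≤
      (1 / Δ - 1) * Real.exp (-(n * bzRate ε))) ∧
    (∀ n : ℕ, K = ⌈(2 : ℝ) ^ (1 / 3 : ℝ) * Real.exp (n * bzRate ε / 3)⌉₊ →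
      Integrable (fun ω => (X ω - Xhat n ω) ^ 2) μ ∧
      ∫ ω, (X ω - Xhat n ω) ^ 2 ∂μ ≤
        ((2 : ℝ) ^ (-(2 / 3) : ℝ) + (2 : ℝ) ^ (1 / 3 : ℝ)) *
          Real.exp (-(2 / 3 * (n * bzRate ε)))) := by
  subst hΔ
  have hX : ∀ n, (fun ω => (X ω - Xhat n ω) ^ 2) =
      fun ω => (X ω - bzEstimate ε K (fun t => Q t ω) (fun t => Y t ω) n) ^ 2 := fun n => by
    simp only [hXhat]
  refine ⟨fun n => ?_, fun n hn => ?_⟩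
  · simp only [hXhat, one_div_one_div]
    exact hrun.measureReal_estimate_gt_le hε hK n
  · rw [hX]
    exact ⟨hrun.integrable_sq_error n,
      (hrun.integral_sq_error_le hε hK n).trans (sq_one_div_add_le_of_eq_ceil hn)⟩
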